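/- Let $F$ be a field of characteristic $2$. A *quasilinear quadratic form* over $F$ is a map $q\colon V_q\to F$ on a finite-dimensional $F$-vector space such that $q(\lambda v)=\lambda^2q(v)$ and $q(v+w)=q(v)+q(w)$ for all $\lambda\in F$, $v,w\in V_q$. Put $\dim q=\dim_F V_q$ and $D(q)=q(V_q)$. The form $q$ is *anisotropic* if $q(v)=0$ only for $v=0$. The *isotropy index* $\mathfrak i_0(q)$ is the maximal dimension of a subspace of $V_q$ on which $q$ vanishes. The set $U=\{v\in V_q : q(v)=0\}$ is a subspace of $V_q$, and the *anisotropic part* $q_{\mathrm{an}}$ is the form induced by $q$ on $V_q/U$. For a field extension $L/F$, $q_L$ denotes the form on $L\otimes_F V_q$ with $q_L(l\otimes v)=l^2q(v)$. The *tensor product* $p\otimes q$ is the quasilinear form on $V_p\otimes_F V_q$ with $(p\otimes q)(v\otimes w)=p(v)q(w)$. For $s\ge 0$, an *$s$-fold quasi-Pfister form* is a form $\langle 1,a_1\rangle\otimes\cdots\otimes\langle 1,a_s\rangle$ with $a_1,\dots,a_s\in F^*$ (the form $\langle 1\rangle$ if $s=0$), where $\langle a,b\rangle$ is the form $(x,y)\mapsto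 ax^2+by^2$ on $F^2$. For $q\neq 0$, the *divisibility index* $\mathfrak d_0(q)$ is the largest $s\ge 0$ such that $q_{\mathrm{an}}\simeq\pi\otimes r$ for some $s$-fold quasi-Pfister form $\pi$ and some quasilinear form $r$ over $F$. If $p$ is anisotropic with $\dim p\ge 2$, let $F(p)$ be the function field of the (integral) projective quadric $\{p=0\}\subset\mathbb P(V_p)$, let $p_1=(p_{F(p)})_{\mathrm{an}}$, and let $\mathfrak d_1(p)=\mathfrak d_0(p_1)$, computed over $F(p)$. Let $N(p)$ be the smallest subfield of $F$ containing all ratios of nonzero elements of $D(p)$; it contains the field $F^2$ of squares, and $\mathrm{lndeg}(p)=\log_2[N(p):F^2]$. **Theorem.** Let $p$ and $q$ be anisotropic quasilinear quadratic forms of dimension $\ge 2$ over a field $F$ of characteristic $2$, and let $\epsilon$ be the unique integer in $[1,2^{\mathfrak d_1(p)}]$ such that $\mathfrak i_0(q_{F(p)})+\epsilon\equiv 0\pmod{2^{\mathfrak d_1(p)}}$. Then at least one of the following holds: 1. $\mathfrak i_0(q_{F(p)})\le \dfrac{\dim q-\epsilon}{2}$; 2. $\mathfrak i_0(q_{F(p)})$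 is divisible by $2^{\mathrm{lndeg}(p)-1}$. -/

import Mathlib

open scoped TensorProduct

universe u v w

/-- A quasilinear quadratic form on the `F`-vector space `V`: a quadratic form `q : V → F` that
is additive, `q (x + y) = q x + q y`. -/
structure QuasilinearForm (F : Type u) (V : Type v) [Field F] [AddCommGroup V] [Module F V]
    extends QuadraticMap F V F where
  map_add' : ∀ x y : V, toFun (x + y) = toFun x + toFun y

namespace QuasilinearForm

section Basic

variable {F : Type u} {V : Type v} {W : Type w} [Field F]
  [AddCommGroup V] [Module F V] [AddCommGroup W] [Module F W]

/-- Build a quasilinear form from an additive map `f` with `f (c • x) = c² f x`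
(the polar form is then zero, so `f` is a quadratic form). -/
def ofAddHom (f : V →+ F) (hf : ∀ (c : F) (x : V), f (c • x) = c * c * f x) :
    QuasilinearForm F V where
  toFun := f
  toFun_smul := fun c x => by simpa using hf c x
  exists_companion' := ⟨0, fun x y => by simp⟩
  map_add' := fun x y => f.map_add x y

/-- The additive map underlying a quasilinear form. -/
def toAddHom (q : QuasilinearForm F V) : V →+ F :=
  AddMonoidHom.mk' q.toQuadraticMap q.map_add'

theorem toAddHom_smul (q : QuasilinearForm F V) (c : F) (x : V) :
    q.toAddHom (c • x) = c * c * q.toAddHom x := q.toQuadraticMap.map_smul c x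

/-- A form is anisotropic if `q x = 0` only for `x = 0`. -/
def Anisotropic (q : QuasilinearForm F V) : Prop := q.toQuadraticMap.Anisotropic

/-- Isometry of forms. -/
def Isometric (p : QuasilinearForm F V) (q : QuasilinearForm F W) : Prop :=
  p.toQuadraticMap.Equivalent q.toQuadraticMap

/-- The set `D(q)` of elements of `F` represented by `q`. -/
def values (q : QuasilinearForm F V) : Set F := Set.range q.toQuadraticMap

/-- The subspace of all isotropic vectors of `q`; it is the largest totally isotropic subspace. -/
def isotropicVectors (q : QuasilinearForm F V) : Submodule F V where
  carrier := {x | q.toAddHom x = 0}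
  zero_mem' := q.toAddHom.map_zero
  add_mem' := fun {x y} hx hy => by
    simp only [Set.mem_ofPred_eq] at hx hy ⊢
    rw [map_add, hx, hy, add_zero]
  smul_mem' := fun c x hx => by
    simp only [Set.mem_ofPred_eq] at hx ⊢
    rw [toAddHom_smul, hx, mul_zero]

/-- The isotropy index `𝔦₀(q)`: the maximal dimension of a totally isotropic subspace. As the
isotropic vectors form a subspace, this is the dimension of that subspace. -/
noncomputable def isotropyIndex (q : QuasilinearForm F V) : ℕ :=
  Module.finrank F q.isotropicVectors

/-- The anisotropic part of `q`: the form induced by `q` on the quotient of `V` by the subspace of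
isotropic vectors. -/
def anisotropicPart (q : QuasilinearForm F V) : QuasilinearForm F (V ⧸ q.isotropicVectors) :=
  ofAddHom (QuotientAddGroup.lift q.isotropicVectors.toAddSubgroup q.toAddHom fun _ hx => hx)
    fun c x => by
      obtain ⟨y, rfl⟩ := Submodule.Quotient.mk_surjective _ x
      exact q.toAddHom_smul c y

/-- The tensor product `p ⊗ q`, with `(p ⊗ q)(x ⊗ y) = p x * q y`. -/
noncomputable def tensor (p : QuasilinearForm F V) (q : QuasilinearForm F W) :
    QuasilinearForm F (V ⊗[F] W) :=
  ofAddHom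
    (TensorProduct.liftAddHom
      (AddMonoidHom.mk' (fun x => (AddMonoidHom.mulLeft (p.toAddHom x)).comp q.toAddHom)
        fun x x' => by
          ext y
          simp [add_mul])
      fun c x y => by
        simp only [AddMonoidHom.mk'_apply, AddMonoidHom.comp_apply, AddMonoidHom.coe_mulLeft,
          toAddHom_smul]
        ring)
    fun c t => by
      induction t using TensorProduct.induction_on with
      | zero => simp
      | add s t hs ht => rw [smul_add, map_add, map_add, hs, ht, mul_add]
      | tmul x y =>
        rw [TensorProduct.smul_tmul']
        simp only [TensorProduct.liftAddHom_tmul, AddMonoidHom.mk'_apply,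
          AddMonoidHom.comp_apply, AddMonoidHom.coe_mulLeft, toAddHom_smul]
        ring

/-- The norm field `N(q)`: the smallest subfield of `F` containing all ratios of nonzero elements
of `D(q)`. -/
def normField (q : QuasilinearForm F V) : Subfield F :=
  Subfield.closure {x | ∃ a ∈ q.values, ∃ b ∈ q.values, a ≠ 0 ∧ b ≠ 0 ∧ x = a / b}

end Basic

section CharTwo

variable {F : Type u} {V : Type v} {W : Type w} [Field F] [CharP F 2]
  [AddCommGroup V] [Module F V] [AddCommGroup W] [Module F W]

/-- `lndeg(q) = log₂ [N(q) : F²]`, where `F²` is the subfield of squares of `F`. -/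
noncomputable def lndeg (q : QuasilinearForm F V) : ℕ :=
  Nat.log 2 (Subfield.relfinrank (frobenius F 2).fieldRange q.normField)

/-- The scalar extension `q_L` of `q` to a field extension `L` of `F`: the form on `L ⊗ V` with
`q_L (l ⊗ x) = l² q x`. -/
noncomputable def baseChange (L : Type w) [Field L] [Algebra F L] [CharP L 2]
    (q : QuasilinearForm F V) : QuasilinearForm L (L ⊗[F] V) :=
  ofAddHom
    (TensorProduct.liftAddHom
      (AddMonoidHom.mk'
        (fun l => (AddMonoidHom.mulLeft (l * l)).comp
          ((algebraMap F L : F →+ L).comp q.toAddHom))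
        fun a b => by
          ext x
          simp only [AddMonoidHom.comp_apply, AddMonoidHom.coe_mulLeft, AddMonoidHom.add_apply]
          rw [CharTwo.add_mul_self, add_mul])
      fun c l x => by
        simp only [AddMonoidHom.mk'_apply, AddMonoidHom.comp_apply, AddMonoidHom.coe_mulLeft,
          toAddHom_smul, AddMonoidHom.coe_coe, map_mul, Algebra.smul_def]
        ring)
    fun c t => by
      induction t using TensorProduct.induction_on with
      | zero => simp
      | add s t hs ht => rw [smul_add, map_add, map_add, hs, ht, mul_add]
      | tmul l x =>
        rw [TensorProduct.smul_tmul']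
        simp only [TensorProduct.liftAddHom_tmul, AddMonoidHom.mk'_apply,
          AddMonoidHom.comp_apply, AddMonoidHom.coe_mulLeft, smul_eq_mul]
        ring

/-- The diagonal form `⟨aᵢ⟩ᵢ : x ↦ ∑ᵢ aᵢ xᵢ²`. -/
def diagonal {ι : Type w} [Fintype ι] (a : ι → F) : QuasilinearForm F (ι → F) :=
  ofAddHom
    (AddMonoidHom.mk' (fun x => ∑ i, a i * (x i * x i)) fun x y => by
      rw [← Finset.sum_add_distrib]
      refine Finset.sum_congr rfl fun i _ => ?_
      rw [Pi.add_apply, CharTwo.add_mul_self, mul_add])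
    fun c x => by
      simp only [AddMonoidHom.mk'_apply, Pi.smul_apply, smul_eq_mul, Finset.mul_sum]
      exact Finset.sum_congr rfl fun i _ => by ring

/-- The `s`-fold quasi-Pfister form `⟨⟨a₁, …, aₛ⟩⟩ = ⟨1, a₁⟩ ⊗ ⋯ ⊗ ⟨1, aₛ⟩` with nonzero `aᵢ`,
written as a diagonal form: its coefficients are the products of the `aᵢ` over the subsets of the
index set. It has dimension `2 ^ s`, and is `⟨1⟩` for `s = 0`. -/
def quasiPfister {s : ℕ} (a : Fin s → Fˣ) : QuasilinearForm F (Finset (Fin s) → F) :=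
  diagonal fun S => ∏ i ∈ S, (a i : F)

/-- `q` is divisible by `π` if `q ≃ π ⊗ r` for some form `r` (on a finite-dimensional space,
without loss of generality a coordinate space). -/
def DivisibleBy (q : QuasilinearForm F V) (π : QuasilinearForm F W) : Prop :=
  ∃ (m : ℕ) (r : QuasilinearForm F (Fin m → F)), q.Isometric (π.tensor r)

/-- The divisibility index `𝔡₀(q)` of a nonzero form `q`: the largest `s` such that the anisotropic
part of `q` is divisible by an `s`-fold quasi-Pfister form. -/
noncomputable def divisibilityIndex (q : QuasilinearForm F V) : ℕ :=
  sSup {s : ℕ | ∃ a : Fin s → Fˣ, q.anisotropicPart.DivisibleBy (quasiPfister a)}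

end CharTwo

section FunctionField

variable {F : Type u} {V : Type v} [Field F] [AddCommGroup V] [Module F V]
  [FiniteDimensional F V]

/-- The form `p` as a homogeneous polynomial `∑ᵢ p(eᵢ) Xᵢ²` of degree two in the coordinates with
respect to a basis `e` of `V`. -/
noncomputable def polynomial (p : QuasilinearForm F V) :
    MvPolynomial (Fin (Module.finrank F V)) F :=
  ∑ i, MvPolynomial.C (p.toQuadraticMap (Module.finBasis F V i)) * MvPolynomial.X i ^ 2

/-- The (homogeneous) coordinate ring `F[X] / (p)` of the quadric `p = 0`. -/
abbrev CoordinateRing (p : QuasilinearForm F V) : Type u :=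
  MvPolynomial (Fin (Module.finrank F V)) F ⧸ Ideal.span {p.polynomial}

theorem irreducible_polynomial (p : QuasilinearForm F V) (hp : p.Anisotropic)
    (hd : 2 ≤ Module.finrank F V) : Irreducible p.polynomial := by
  classical
  let e := Module.finBasis F V
  have hadd : ∀ x y, p.toQuadraticMap (x + y) = p.toQuadraticMap x + p.toQuadraticMap y :=
    p.map_add'
  have hP : p.polynomial.totalDegree ≤ 2 := by
    refine MvPolynomial.totalDegree_finsetSum_le fun i _ => ?_
    refine (MvPolynomial.totalDegree_mul _ _).trans ?_
    simp
  let i : Fin (Module.finrank F V) := ⟨0, by omega⟩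
  let j : Fin (Module.finrank F V) := ⟨1, by omega⟩
  have hij : i ≠ j := by simp [i, j]
  let s : Fin (Module.finrank F V) → Polynomial F :=
    fun k => if k = i then Polynomial.X else if k = j then 1 else 0
  have hs : ∀ k, (s k).natDegree ≤ 1 := by
    intro k
    simp only [s]
    split_ifs <;> simp
  let a := p.toQuadraticMap (e i)
  let b := p.toQuadraticMap (e j)
  have ha : a ≠ 0 := fun h => e.ne_zero i (hp _ h)
  have hφ : MvPolynomial.aeval s p.polynomial
      = Polynomial.C a * Polynomial.X ^ 2 + Polynomial.C b := by
    have h1 : ∀ k, MvPolynomial.aeval s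
        (MvPolynomial.C (p.toQuadraticMap (e k)) * MvPolynomial.X k ^ 2)
        = (if k = i then Polynomial.C a * Polynomial.X ^ 2 else 0)
          + (if k = j then Polynomial.C b else 0) := by
      intro k
      by_cases hki : k = i
      · subst hki
        simp [s, hij, a, ← MvPolynomial.algebraMap_eq, Polynomial.algebraMap_eq]
      · by_cases hkj : k = j
        · subst hkj
          simp [s, hij.symm, b, ← MvPolynomial.algebraMap_eq, Polynomial.algebraMap_eq]
        · simp [s, hki, hkj]
    rw [polynomial, map_sum, Finset.sum_congr rfl fun k _ => h1 k, Finset.sum_add_distrib]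
    simp
  have hdeg : (Polynomial.C a * Polynomial.X ^ 2 + Polynomial.C b).natDegree = 2 := by
    have := Polynomial.natDegree_quadratic (a := a) (b := 0) (c := b) ha
    simpa using this
  have hirr : Irreducible (Polynomial.C a * Polynomial.X ^ 2 + Polynomial.C b) := by
    refine Polynomial.irreducible_of_degree_le_three_of_not_isRoot ?_ fun t ht => ?_
    · rw [hdeg]; simp
    · have h0 : p.toQuadraticMap (t • e i + e j) = 0 := by
        rw [hadd, QuadraticMap.map_smul]
        have := ht
        simp only [Polynomial.IsRoot, Polynomial.eval_add, Polynomial.eval_mul,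
          Polynomial.eval_C, Polynomial.eval_pow, Polynomial.eval_X] at this
        rw [← this, smul_eq_mul]
        ring
      have h1 := congrArg (fun v => e.repr v j) (hp _ h0)
      simp [hij] at h1
  have hdegs : ∀ f : MvPolynomial (Fin (Module.finrank F V)) F,
      (MvPolynomial.aeval s f).natDegree ≤ f.totalDegree := by
    intro f
    simpa using MvPolynomial.aeval_natDegree_le f le_rfl s hs
  have h0 : p.polynomial ≠ 0 := by
    intro h
    rw [h, map_zero] at hφ
    rw [← hφ] at hdeg
    simp at hdeg
  have key : ∀ f g, p.polynomial = f * g → IsUnit (MvPolynomial.aeval s f) → IsUnit f := by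
    intro f g hfg hu
    have hf0 : f ≠ 0 := by rintro rfl; simp at hfg; exact h0 hfg
    have hg0 : g ≠ 0 := by rintro rfl; simp at hfg; exact h0 hfg
    have ht := MvPolynomial.totalDegree_mul_of_isDomain hf0 hg0
    rw [← hfg] at ht
    have hm : MvPolynomial.aeval s f * MvPolynomial.aeval s g
        = Polynomial.C a * Polynomial.X ^ 2 + Polynomial.C b := by
      rw [← map_mul, ← hfg, hφ]
    have hn : (MvPolynomial.aeval s g).natDegree = 2 := by
      have hg' : MvPolynomial.aeval s g ≠ 0 := by
        intro h
        rw [h, mul_zero] at hm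
        rw [← hm] at hdeg
        simp at hdeg
      have := Polynomial.natDegree_mul hu.ne_zero hg'
      rw [hm, hdeg, Polynomial.natDegree_eq_zero_of_isUnit hu] at this
      omega
    have hf : f.totalDegree = 0 := by
      have := hdegs g
      omega
    rw [MvPolynomial.totalDegree_eq_zero_iff_eq_C] at hf
    rw [hf] at hf0 ⊢
    refine IsUnit.map (MvPolynomial.C (σ := Fin (Module.finrank F V)) (R := F)) (Ne.isUnit ?_)
    rintro h
    rw [h] at hf0
    simp at hf0
  refine ⟨fun hu => ?_, fun f g hfg => ?_⟩
  · have := hu.map (MvPolynomial.aeval s)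
    rw [hφ] at this
    exact hirr.not_isUnit this
  · have hm : Polynomial.C a * Polynomial.X ^ 2 + Polynomial.C b
        = MvPolynomial.aeval s f * MvPolynomial.aeval s g := by
      rw [← map_mul, ← hfg, hφ]
    rcases hirr.isUnit_or_isUnit hm with h | h
    · exact Or.inl (key f g hfg h)
    · exact Or.inr (key g f (by rw [hfg, mul_comm]) h)

theorem isDomain_coordinateRing (p : QuasilinearForm F V) (hp : p.Anisotropic)
    (hd : 2 ≤ Module.finrank F V) : IsDomain p.CoordinateRing := by
  have h := p.irreducible_polynomial hp hd
  have : (Ideal.span {p.polynomial}).IsPrime :=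
    (Ideal.span_singleton_prime h.ne_zero).2 h.prime
  exact Ideal.Quotient.isDomain _

/-- `F[p]`, the field of fractions of the coordinate ring: the function field of the affine cone
`p = 0`. -/
abbrev AffineFunctionField (p : QuasilinearForm F V) : Type u :=
  FractionRing p.CoordinateRing

/-- The class in `F[p]` of a polynomial. -/
noncomputable def polyClass (p : QuasilinearForm F V) :
    MvPolynomial (Fin (Module.finrank F V)) F →ₐ[F] p.AffineFunctionField :=
  (IsScalarTower.toAlgHom F p.CoordinateRing p.AffineFunctionField).comp
    (Ideal.Quotient.mkₐ F (Ideal.span {p.polynomial}))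

/-- `F[p]` is a field when `p` is anisotropic of dimension at least two. -/
noncomputable abbrev affineField (p : QuasilinearForm F V) (hp : p.Anisotropic)
    (hd : 2 ≤ Module.finrank F V) : Field p.AffineFunctionField :=
  haveI := p.isDomain_coordinateRing hp hd
  FractionRing.field p.CoordinateRing

/-- The function field `F(p)` of the projective quadric `p = 0`, as a subfield of `F[p]`: it
consists of the fractions `f / g` with `f`, `g` homogeneous of the same degree and `g ≠ 0` in
`F[p]`. -/
noncomputable def degreeZeroFractions (p : QuasilinearForm F V) (hp : p.Anisotropic)
    (hd : 2 ≤ Module.finrank F V) :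
    letI := p.affineField hp hd
    IntermediateField F p.AffineFunctionField :=
  letI := p.affineField hp hd
  { carrier := {x | ∃ (n : ℕ) (f g : MvPolynomial (Fin (Module.finrank F V)) F),
      f.IsHomogeneous n ∧ g.IsHomogeneous n ∧ p.polyClass g ≠ 0 ∧
        x = p.polyClass f / p.polyClass g}
    mul_mem' := by
      rintro _ _ ⟨m, f, g, hf, hg, h0, rfl⟩ ⟨n, f', g', hf', hg', h0', rfl⟩
      refine ⟨m + n, f * f', g * g', hf.mul hf', hg.mul hg', ?_, ?_⟩
      · rw [map_mul]; exact mul_ne_zero h0 h0'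
      · rw [map_mul, map_mul, div_mul_div_comm]
    add_mem' := by
      rintro _ _ ⟨m, f, g, hf, hg, h0, rfl⟩ ⟨n, f', g', hf', hg', h0', rfl⟩
      refine ⟨m + n, f * g' + g * f', g * g', (hf.mul hg').add (hg.mul hf'), hg.mul hg', ?_, ?_⟩
      · rw [map_mul]; exact mul_ne_zero h0 h0'
      · rw [map_add, map_mul, map_mul, map_mul, div_add_div _ _ h0 h0']
    algebraMap_mem' := fun c => by
      refine ⟨0, MvPolynomial.C c, 1, MvPolynomial.isHomogeneous_C _ c,
        MvPolynomial.isHomogeneous_one _ _, ?_, ?_⟩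
      · rw [map_one]; exact one_ne_zero
      · rw [map_one, div_one, ← MvPolynomial.algebraMap_eq, AlgHom.commutes]
    inv_mem' := by
      rintro _ ⟨n, f, g, hf, hg, h0, rfl⟩
      by_cases h : p.polyClass f = 0
      · refine ⟨n, f, g, hf, hg, h0, ?_⟩
        rw [h, zero_div, inv_zero]
      · exact ⟨n, g, f, hg, hf, h, inv_div _ _⟩ }

/-- The function field `F(p)` of the projective quadric defined by an anisotropic quasilinear form
`p` of dimension at least two. -/
def FunctionField (p : QuasilinearForm F V) (hp : p.Anisotropic)
    (hd : 2 ≤ Module.finrank F V) : Type u :=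
  letI := p.affineField hp hd
  p.degreeZeroFractions hp hd

noncomputable instance (p : QuasilinearForm F V) (hp : p.Anisotropic)
    (hd : 2 ≤ Module.finrank F V) : Field (p.FunctionField hp hd) :=
  letI := p.affineField hp hd
  inferInstanceAs (Field (p.degreeZeroFractions hp hd))

noncomputable instance (p : QuasilinearForm F V) (hp : p.Anisotropic)
    (hd : 2 ≤ Module.finrank F V) : Algebra F (p.FunctionField hp hd) :=
  letI := p.affineField hp hd
  inferInstanceAs (Algebra F (p.degreeZeroFractions hp hd))

instance [CharP F 2] (p : QuasilinearForm F V) (hp : p.Anisotropic)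
    (hd : 2 ≤ Module.finrank F V) : CharP (p.FunctionField hp hd) 2 :=
  charP_of_injective_algebraMap (algebraMap F (p.FunctionField hp hd)).injective 2

/-- The scalar extension `q_{F(p)}` of a form `q` to the function field of `p`. -/
noncomputable def extendToFunctionField {W : Type w} [AddCommGroup W] [Module F W] [CharP F 2]
    (q : QuasilinearForm F W) (p : QuasilinearForm F V) (hp : p.Anisotropic)
    (hd : 2 ≤ Module.finrank F V) :
    QuasilinearForm (p.FunctionField hp hd) (p.FunctionField hp hd ⊗[F] W) :=
  q.baseChange (p.FunctionField hp hd)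

/-- The divisibility index `𝔡₁(p) = 𝔡₀(p₁)`, where `p₁` is the first higher anisotropic kernel of
the anisotropic form `p`, i.e. the anisotropic part of `p_{F(p)}`. -/
noncomputable def firstDivisibilityIndex [CharP F 2] (p : QuasilinearForm F V)
    (hp : p.Anisotropic) (hd : 2 ≤ Module.finrank F V) : ℕ :=
  (p.extendToFunctionField p hp hd).anisotropicPart.divisibilityIndex

end FunctionField

end QuasilinearForm

/-! Let `L = F(p)`, let `E` be a perfect field containing the function field of the affine cone, and
write `i` for the isotropy index of `q` over `L`. A diagonal form with coefficients `d_b` is the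
square of the `L`-linear map `t ↦ ∑ t_b √d_b` into `E` (`sqrtComb`). For `q`, the kernel of this map
has dimension `i`, and its range `D`, the square roots of the values of `q_L`, has dimension `dim q
- i`.

The heart is `exists_submodule_mul_mem_range_sqrtComb`. An isotropic vector over `L` is, up to a
denominator, a tuple of forms `f_b` of equal degree with `∑ d_b f_b² = p G`. The classes `√G`,
suitably normalized, span a space `R` of dimension `i`: a relation between them gives a multiple of
`p²`, and anisotropy over `F` then makes `p` divide the corresponding combination of the tuples.
Differentiating the square root of the equation gives `a_j G ≡ ∑ d_b (∂_j f_b)²` modulo `p`, so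
`√a_j R ⊆ D`.

Let `A` be the space of square roots of values of `p_L`. Then `A R ⊆ D`. A quasi-Pfister divisor of
`p₁` acts on `A`, hence on `A R`, through square roots of its values, so `2 ^ 𝔡₁(p)` divides `dim A
R`. If `dim A R > i`, this forces `dim A R ≥ i + ε`, and comparison with `dim D` gives the first
alternative. Otherwise `√p(v) R = A R` whenever `p(v) ≠ 0`, so `R` is stable under the square roots
of `N(p)`. Over `L` these span a space of dimension at least `2 ^ (lndeg p - 1)`, by the same lemma
applied to a basis of `N(p)` over the squares, and the second alternative follows. -/

/-! ### Square roots in a perfect extension -/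

section SquareRoot

theorem CharTwo.eq_of_sq_eq_sq {E : Type*} [Field E] [CharP E 2] {x y : E}
    (h : x ^ 2 = y ^ 2) : x = y :=
  frobenius_inj E 2 h

variable (F : Type*) (E : Type*) [Field F] [Field E] [Algebra F E] [CharP E 2] [PerfectRing E 2]

/-- The square root map from `F` to a perfect extension field of characteristic two. -/
noncomputable def sqrtMap : F →+* E :=
  ((frobeniusEquiv E 2).symm : E →+* E).comp (algebraMap F E)

variable {F E}

theorem sqrtMap_sq (x : F) : sqrtMap F E x ^ 2 = algebraMap F E x :=
  frobeniusEquiv_symm_pow_p E 2 _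

theorem sqrtMap_of_sq (x : F) : sqrtMap F E (x ^ 2) = algebraMap F E x := by
  rw [map_pow, sqrtMap_sq]

/-- Elements of `F` that are linearly independent over the squares have linearly independent
square roots. -/
theorem linearIndependent_sqrtMap {ι : Type*} [Fintype ι] {d : ι → F}
    (hd : ∀ t : ι → F, ∑ b, d b * t b ^ 2 = 0 → t = 0) :
    LinearIndependent F fun b => sqrtMap F E (d b) := by
  rw [Fintype.linearIndependent_iff]
  intro t ht b
  refine congrFun (hd t ?_) b
  apply (sqrtMap F E).injective
  rw [map_zero, ← ht, map_sum]
  refine Finset.sum_congr rfl fun b _ => ?_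
  rw [map_mul, sqrtMap_of_sq, Algebra.smul_def, mul_comm]

end SquareRoot

/-! ### Polynomials: descent of divisibility and diagonal sums of squares -/

namespace MvPolynomial

section Coefficientwise

variable {F : Type*} {E : Type*} [Field F] [Field E] [Algebra F E] {σ : Type*}

/-- Apply a linear functional to each coefficient of a polynomial. -/
noncomputable def mapCoeff (φ : E →ₗ[F] F) (h : MvPolynomial σ E) : MvPolynomial σ F :=
  ∑ m ∈ h.support, monomial m (φ (coeff m h))

theorem coeff_mapCoeff (φ : E →ₗ[F] F) (h : MvPolynomial σ E) (m : σ →₀ ℕ) :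
    coeff m (mapCoeff φ h) = φ (coeff m h) := by
  classical
  rw [mapCoeff, coeff_sum]
  simp only [coeff_monomial]
  rw [Finset.sum_ite_eq']
  split_ifs with hm
  · rfl
  · rw [notMem_support_iff.1 hm, map_zero]

theorem mapCoeff_map_mul (φ : E →ₗ[F] F) (f : MvPolynomial σ F) (h : MvPolynomial σ E) :
    mapCoeff φ (map (algebraMap F E) f * h) = f * mapCoeff φ h := by
  classical
  ext m
  rw [coeff_mapCoeff, coeff_mul, coeff_mul, map_sum]
  refine Finset.sum_congr rfl fun x _ => ?_
  rw [coeff_map, coeff_mapCoeff, ← Algebra.smul_def, map_smul, smul_eq_mul]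

theorem mapCoeff_sum_C_mul_map {ι : Type*} (s : Finset ι) (φ : E →ₗ[F] F) (e : ι → E)
    (f : ι → MvPolynomial σ F) :
    mapCoeff φ (∑ b ∈ s, C (e b) * map (algebraMap F E) (f b)) = ∑ b ∈ s, C (φ (e b)) * f b := by
  ext m
  rw [coeff_mapCoeff, coeff_sum, coeff_sum, map_sum]
  refine Finset.sum_congr rfl fun b _ => ?_
  rw [coeff_C_mul, coeff_C_mul, coeff_map, mul_comm, ← Algebra.smul_def, map_smul, smul_eq_mul,
    mul_comm]

/-- Applying an `F`-linear functional to the coefficients is linear over polynomials with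
coefficients in `F`. A functional dual to `e b` therefore turns the quotient over `E` into a
quotient of `f b` by `g`. -/
theorem dvd_of_map_dvd_sum {ι : Type*} [Fintype ι] {e : ι → E} (he : LinearIndependent F e)
    {g : MvPolynomial σ F} {f : ι → MvPolynomial σ F}
    (h : map (algebraMap F E) g ∣ ∑ b, C (e b) * map (algebraMap F E) (f b)) (b : ι) :
    g ∣ f b := by
  classical
  obtain ⟨H, hH⟩ := h
  obtain ⟨φ, hφ⟩ := (Module.Basis.span he).constr F (fun i => if i = b then (1 : F) else 0)
    |>.exists_extend
  have hφ' (i : ι) : φ (e i) = if i = b then (1 : F) else 0 := by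
    have := LinearMap.congr_fun hφ (Module.Basis.span he i)
    rw [Module.Basis.constr_basis] at this
    rw [← this]
    simp [Module.Basis.span_apply]
  refine ⟨mapCoeff φ H, ?_⟩
  rw [← mapCoeff_map_mul, ← hH, mapCoeff_sum_C_mul_map]
  simp [hφ', ite_mul, apply_ite C]

theorem dvd_of_map_dvd_map {g f : MvPolynomial σ F}
    (h : map (algebraMap F E) g ∣ map (algebraMap F E) f) : g ∣ f := by
  have := dvd_of_map_dvd_sum (ι := Unit) (e := fun _ => (1 : E)) (g := g) (f := fun _ => f)
    (by rw [linearIndependent_unique_iff]; exact one_ne_zero) (by simpa using h) ()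
  exact this

end Coefficientwise

section SumOfSquares

variable {F : Type*} [Field F] {σ ι : Type*} [Fintype ι]

theorem map_sum_C_mul_sq {E : Type*} [Field E] [Algebra F E] [CharP E 2] [PerfectRing E 2]
    (d : ι → F) (f : ι → MvPolynomial σ F) :
    map (algebraMap F E) (∑ b, C (d b) * f b ^ 2) =
      (∑ b, C (sqrtMap F E (d b)) * map (algebraMap F E) (f b)) ^ 2 := by
  rw [CharTwo.sum_sq, map_sum]
  refine Finset.sum_congr rfl fun b _ => ?_
  rw [map_mul, map_C, map_pow, mul_pow, ← C_pow, sqrtMap_sq]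

/-- Over the algebraic closure the equation reads `μ² = ℓ² G` with `ℓ` linear. Hence `μ = ℓ ν` and
`G = ν²`, and the product rule gives `∂_j μ = √a_j ν + ℓ ∂_j ν`. Squaring yields the congruence,
which descends to `F`. -/
theorem dvd_pderiv_of_sum_C_mul_sq_eq [CharP F 2] [Fintype σ] (a : σ → F)
    (ha : ∃ i, a i ≠ 0) (d : ι → F)
    {f : ι → MvPolynomial σ F} {G : MvPolynomial σ F}
    (h : ∑ b, C (d b) * f b ^ 2 = (∑ i, C (a i) * X i ^ 2) * G) (j : σ) :
    (∑ i, C (a i) * X i ^ 2 : MvPolynomial σ F) ∣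
      ∑ b, C (d b) * pderiv j (f b) ^ 2 - C (a j) * G := by
  classical
  let E := AlgebraicClosure F
  have : CharP E 2 := charP_of_injective_algebraMap (algebraMap F E).injective 2
  set ℓ : MvPolynomial σ E := ∑ i, C (sqrtMap F E (a i)) * X i with hℓ
  set μ : MvPolynomial σ E := ∑ b, C (sqrtMap F E (d b)) * map (algebraMap F E) (f b) with hμ
  have hp : map (algebraMap F E) (∑ i, C (a i) * X i ^ 2) = ℓ ^ 2 := by
    rw [map_sum_C_mul_sq, hℓ]; simp
  have hℓj (k : σ) : pderiv k ℓ = C (sqrtMap F E (a k)) := by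
    simp [hℓ, pderiv_X, Pi.single_apply]
  have hℓ0 : ℓ ≠ 0 := by
    obtain ⟨i, hi⟩ := ha
    intro h0
    have := hℓj i
    rw [h0, map_zero, eq_comm, ← C_0] at this
    exact hi ((map_eq_zero _).1 (C_injective _ _ this))
  have hsq : μ ^ 2 = ℓ ^ 2 * map (algebraMap F E) G := by
    rw [← hp, ← map_mul, ← h, map_sum_C_mul_sq]
  obtain ⟨ν, hν⟩ : ℓ ∣ μ := by
    rw [← UniqueFactorizationMonoid.pow_dvd_pow_iff_dvd two_ne_zero]
    exact ⟨_, hsq⟩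
  have hG : map (algebraMap F E) G = ν ^ 2 := by
    rw [hν, mul_pow] at hsq
    exact (mul_left_cancel₀ (pow_ne_zero 2 hℓ0) hsq).symm
  have hd : ∑ b, C (sqrtMap F E (d b)) * map (algebraMap F E) (pderiv j (f b)) =
      C (sqrtMap F E (a j)) * ν + ℓ * pderiv j ν := by
    have h1 : pderiv j μ = ∑ b, C (sqrtMap F E (d b)) * map (algebraMap F E) (pderiv j (f b)) := by
      simp [hμ, pderiv_map]
    rw [← h1, hν, Derivation.leibniz, hℓj, smul_eq_mul, smul_eq_mul]
    ring
  refine dvd_of_map_dvd_map (E := E) ⟨pderiv j ν ^ 2, ?_⟩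
  rw [map_sub, map_sum_C_mul_sq, hd, hp, map_mul, map_C, hG, CharTwo.add_sq, mul_pow, ← C_pow,
    sqrtMap_sq]
  ring

/-- Over the algebraic closure the sum is the square of `∑ √d_b f_b`, so `g` divides this root. The
`√d_b` are independent over `F`, so `g` divides each term. -/
theorem dvd_of_sq_dvd_sum_C_mul_sq [CharP F 2] {g : MvPolynomial σ F} {d : ι → F}
    (hd : ∀ t : ι → F, ∑ b, d b * t b ^ 2 = 0 → t = 0) {f : ι → MvPolynomial σ F}
    (hg : g ^ 2 ∣ ∑ b, C (d b) * f b ^ 2) (b : ι) : g ∣ f b := by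
  let E := AlgebraicClosure F
  have : CharP E 2 := charP_of_injective_algebraMap (algebraMap F E).injective 2
  refine dvd_of_map_dvd_sum (linearIndependent_sqrtMap (E := E) hd) ?_ b
  rw [← UniqueFactorizationMonoid.pow_dvd_pow_iff_dvd two_ne_zero, ← map_sum_C_mul_sq, ← map_pow]
  exact map_dvd _ hg

end SumOfSquares

end MvPolynomial

/-! ### The space attached to isotropic vectors over the function field -/

section FractionsOfForms

open MvPolynomial

variable {F L E : Type*} [Field F] [Field L] [Field E] [Algebra F E] [Algebra L E]
  {σ : Type*}

/-- The image of `L` in `E` consists of the fractions `c f / c g` with `f` and `g` homogeneous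
of the same degree. -/
structure IsHomogeneousFractions (L : Type*) [Field L] [Algebra L E]
    (c : MvPolynomial σ F →ₐ[F] E) : Prop where
  exists_eq : ∀ x : L, ∃ (n : ℕ) (f g : MvPolynomial σ F), f.IsHomogeneous n ∧ g.IsHomogeneous n ∧
    c g ≠ 0 ∧ algebraMap L E x = c f / c g
  exists_algebraMap_eq : ∀ (n : ℕ) (f g : MvPolynomial σ F), f.IsHomogeneous n →
    g.IsHomogeneous n → c g ≠ 0 → ∃ x : L, algebraMap L E x = c f / c g

theorem IsHomogeneousFractions.exists_common_denominator {c : MvPolynomial σ F →ₐ[F] E}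
    (hc : IsHomogeneousFractions L c) {κ : Type*} [Fintype κ] (x : κ → L) :
    ∃ (n : ℕ) (f : κ → MvPolynomial σ F) (g : MvPolynomial σ F), (∀ k, (f k).IsHomogeneous n) ∧
      g.IsHomogeneous n ∧ c g ≠ 0 ∧ ∀ k, algebraMap L E (x k) = c (f k) / c g := by
  classical
  choose n f g hf hg h0 hx using fun k => hc.exists_eq (x k)
  refine ⟨∑ k, n k, fun k => f k * ∏ l ∈ Finset.univ.erase k, g l, ∏ k, g k, fun k => ?_,
    IsHomogeneous.prod _ _ _ fun k _ => hg k, ?_, fun k => ?_⟩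
  · rw [← Finset.add_sum_erase _ _ (Finset.mem_univ k)]
    exact (hf k).mul (IsHomogeneous.prod _ _ _ fun k _ => hg k)
  · rw [map_prod]
    exact Finset.prod_ne_zero_iff.2 fun k _ => h0 k
  · rw [← Finset.mul_prod_erase _ _ (Finset.mem_univ k), map_mul, map_mul, mul_div_mul_right, hx]
    rw [map_prod]
    exact Finset.prod_ne_zero_iff.2 fun k _ => h0 k

variable (L) in
/-- The linear map `t ↦ ∑ t_b √d_b`, the square root of the extension to `L` of the diagonal form
with coefficients `d_b`. -/
noncomputable def sqrtComb [CharP E 2] [PerfectRing E 2] {ι : Type*} [Fintype ι] (d : ι → F) :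
    (ι → L) →ₗ[L] E :=
  Fintype.linearCombination L fun b => sqrtMap F E (d b)

section

variable [CharP E 2] [PerfectRing E 2] {ι : Type*} [Fintype ι]

theorem sqrtComb_apply (d : ι → F) (t : ι → L) :
    sqrtComb (E := E) L d t = ∑ b, algebraMap L E (t b) * sqrtMap F E (d b) := by
  simp [sqrtComb, Fintype.linearCombination_apply, Algebra.smul_def]

theorem sqrtComb_sq [Algebra F L] [IsScalarTower F L E] (d : ι → F) (t : ι → L) :
    sqrtComb (E := E) L d t ^ 2 =
      algebraMap L E (∑ b, algebraMap F L (d b) * (t b * t b)) := by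
  rw [sqrtComb_apply, CharTwo.sum_sq, map_sum]
  refine Finset.sum_congr rfl fun b _ => ?_
  rw [mul_pow, sqrtMap_sq, map_mul, map_mul, ← IsScalarTower.algebraMap_apply]
  ring

theorem finrank_ker_sqrtComb_add (d : ι → F) :
    Module.finrank L (LinearMap.ker (sqrtComb (E := E) L d)) +
      Module.finrank L (LinearMap.range (sqrtComb (E := E) L d)) = Fintype.card ι := by
  rw [add_comm, LinearMap.finrank_range_add_finrank_ker, Module.finrank_fintype_fun_eq_card]

end

/-- Over the function field of the quadric `∑ aᵢ Xᵢ² = 0`, the kernel of `sqrtComb` embeds into `E`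
in such a way that each `√aⱼ` maps the image into the range of `sqrtComb`. -/
theorem exists_submodule_mul_mem_range_sqrtComb [Algebra F L] [IsScalarTower F L E]
    [CharP F 2] [CharP E 2] [PerfectRing E 2] [Fintype σ]
    {c : MvPolynomial σ F →ₐ[F] E} (hc : IsHomogeneousFractions L c) (a : σ → F)
    (hker : ∀ f, c f = 0 ↔ (∑ i, C (a i) * X i ^ 2 : MvPolynomial σ F) ∣ f)
    {i₀ : σ} (ha : a i₀ ≠ 0) (hX : c (X i₀) ≠ 0) {ι : Type*} [Fintype ι] {d : ι → F}
    (hd : ∀ t : ι → F, ∑ b, d b * t b ^ 2 = 0 → t = 0) :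
    ∃ R : Submodule L E, FiniteDimensional L R ∧
      Module.finrank L R = Module.finrank L (LinearMap.ker (sqrtComb (E := E) L d)) ∧
      ∀ j, ∀ r ∈ R, sqrtMap F E (a j) * r ∈ LinearMap.range (sqrtComb (E := E) L d) := by
  classical
  set p : MvPolynomial σ F := ∑ i, C (a i) * X i ^ 2 with hp
  let Z := LinearMap.ker (sqrtComb (E := E) L d)
  let z := Module.finBasis L Z
  let κ := Fin (Module.finrank L Z)
  obtain ⟨n, f', g, hf', hg, hg0, hz'⟩ :=
    hc.exists_common_denominator (fun x : κ × ι => (z x.1 : ι → L) x.2)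
  obtain ⟨f, rfl⟩ : ∃ f : κ → ι → MvPolynomial σ F, f' = fun x => f x.1 x.2 :=
    ⟨fun k b => f' (k, b), rfl⟩
  have hf (k b) : (f k b).IsHomogeneous n := hf' (k, b)
  have hz (k b) : algebraMap L E ((z k : ι → L) b) = c (f k b) / c g := hz' (k, b)
  have hG (k : κ) : ∃ G, ∑ b, C (d b) * f k b ^ 2 = p * G := by
    rw [← dvd_def, ← hker]
    have h1 := congrArg (· ^ 2) (LinearMap.mem_ker.1 (z k).2)
    simp only [sqrtComb_apply, hz, CharTwo.sum_sq, mul_pow, sqrtMap_sq, div_pow] at h1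
    rw [map_sum, ← mul_left_inj' (inv_ne_zero (pow_ne_zero 2 hg0)), Finset.sum_mul, zero_mul,
      ← zero_pow two_ne_zero, ← h1]
    refine Finset.sum_congr rfl fun b _ => ?_
    rw [map_mul, map_pow, ← algebraMap_eq, AlgHom.commutes]
    ring
  choose G hG using hG
  let s : E →+* E := sqrtMap E E
  have hs (x : E) : s x ^ 2 = x := sqrtMap_sq x
  -- `√(G k)` behaves like a form of degree `n - 1`. The factor `X i₀ / g` brings it to degree zero,
  -- so that the derivatives of the `f k b` will produce coefficients in `L`.
  let ρ : κ → E := fun k => s (c (G k)) * (c (X i₀) / c g)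
  have hind : LinearIndependent L ρ := by
    rw [Fintype.linearIndependent_iff]
    intro t ht
    obtain ⟨n', h, e, hh, he, he0, hte⟩ := hc.exists_common_denominator t
    have h1 : c (∑ k, h k ^ 2 * G k) = 0 := by
      have h2 := congrArg (· ^ 2) ht
      simp only [Algebra.smul_def, CharTwo.sum_sq, hte, mul_pow, div_pow, ρ, hs] at h2
      have h3 : (c (X i₀) / (c e * c g)) ^ 2 ≠ 0 := by positivity
      rw [← mul_left_inj' h3, zero_mul, ← zero_pow two_ne_zero, ← h2, map_sum, Finset.sum_mul]
      refine Finset.sum_congr rfl fun k _ => ?_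
      rw [map_mul, map_pow]
      field_simp
    obtain ⟨H, hH⟩ := (hker _).1 h1
    -- One factor `p` comes from `∑ d_b f_kb² = p G_k`, the other from the assumed relation between
    -- the `ρ k`.
    have h4 : p ^ 2 ∣ ∑ b, C (d b) * (∑ k, h k * f k b) ^ 2 := by
      refine ⟨H, ?_⟩
      calc ∑ b, C (d b) * (∑ k, h k * f k b) ^ 2
          = ∑ b, ∑ k, h k ^ 2 * (C (d b) * f k b ^ 2) := by
            refine Finset.sum_congr rfl fun b _ => ?_
            rw [CharTwo.sum_sq, Finset.mul_sum]
            exact Finset.sum_congr rfl fun k _ => by ring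
        _ = p * ∑ k, h k ^ 2 * G k := by
            rw [Finset.sum_comm, Finset.mul_sum]
            refine Finset.sum_congr rfl fun k _ => ?_
            rw [← Finset.mul_sum, hG]
            ring
        _ = p ^ 2 * H := by rw [hH]; ring
    have h5 (b : ι) : c (∑ k, h k * f k b) = 0 :=
      (hker _).2 (dvd_of_sq_dvd_sum_C_mul_sq hd h4 b)
    refine Fintype.linearIndependent_iff.1 z.linearIndependent t ?_
    ext b
    apply (algebraMap L E).injective
    have h6 : ((∑ k, t k • z k : Z) : ι → L) b = ∑ k, t k * (z k : ι → L) b := by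
      simp
    rw [h6, map_sum]
    simp only [map_mul, hte, hz]
    have h7 := h5 b
    rw [map_sum] at h7
    simp only [map_mul] at h7
    simp only [div_mul_div_comm, ← Finset.sum_div, h7]
    simp
  refine ⟨Submodule.span L (Set.range ρ), FiniteDimensional.span_of_finite L (Set.finite_range ρ),
    ?_, fun j r hr => ?_⟩
  · rw [finrank_span_eq_card hind, Fintype.card_fin]
  · suffices h : Submodule.span L (Set.range ρ) ≤ Submodule.comap
        (LinearMap.mulLeft L (sqrtMap F E (a j))) (LinearMap.range (sqrtComb (E := E) L d)) from h hr
    rw [Submodule.span_le]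
    rintro _ ⟨k, rfl⟩
    have h1 := dvd_pderiv_of_sum_C_mul_sq_eq a ⟨i₀, ha⟩ d (hG k) j
    rw [← hker, map_sub, sub_eq_zero] at h1
    have hx (b : ι) : ∃ x : L, algebraMap L E x = c (X i₀ * pderiv j (f k b)) / c g := by
      -- For `n = 0` the `f k b` are constants and their derivatives vanish; otherwise
      -- multiplication by `X i₀` restores the degree lost in differentiating.
      rcases n with _ | n
      · refine ⟨0, ?_⟩
        rw [totalDegree_eq_zero_iff_eq_C.1 ((totalDegree_zero_iff_isHomogeneous σ).2 (hf k b))]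
        simp
      · refine hc.exists_algebraMap_eq (n + 1) _ _ ?_ hg hg0
        have := (isHomogeneous_X F i₀).mul ((hf k b).pderiv (i := j))
        rwa [add_comm] at this
    choose x hx using hx
    refine ⟨x, ?_⟩
    apply CharTwo.eq_of_sq_eq_sq
    simp only [LinearMap.mulLeft_apply, sqrtComb_apply, hx, CharTwo.sum_sq, mul_pow, sqrtMap_sq, ρ,
      hs, div_pow, map_mul]
    have h2 : algebraMap F E (a j) * c (G k) =
        ∑ b, algebraMap F E (d b) * c (pderiv j (f k b)) ^ 2 := by
      simp only [map_sum, map_mul, map_pow, ← algebraMap_eq, AlgHom.commutes] at h1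
      exact h1.symm
    rw [← mul_assoc, h2, Finset.sum_mul]
    exact Finset.sum_congr rfl fun b _ => by ring

end FractionsOfForms

/-! ### Fields of multipliers and divisibility of dimensions -/

section Stabilizer

variable {L E : Type*} [Field L] [Field E] [Algebra L E]

/-- The elements of `E` that map a finite-dimensional subspace into itself form a field. -/
def Submodule.multiplierField (R : Submodule L E) [FiniteDimensional L R] :
    IntermediateField L E where
  carrier := {x | ∀ r ∈ R, x * r ∈ R}
  mul_mem' := fun {x y} hx hy r hr => by rw [mul_assoc]; exact hx _ (hy r hr)
  add_mem' := fun {x y} hx hy r hr => by rw [add_mul]; exact R.add_mem (hx r hr) (hy r hr)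
  algebraMap_mem' := fun c r hr => by rw [← Algebra.smul_def]; exact R.smul_mem c hr
  inv_mem' := fun x hx r hr => by
    rcases eq_or_ne x 0 with rfl | h0
    · simp
    -- Multiplication by `x` is injective on the finite-dimensional `R`, hence surjective, so
    -- division by `x` preserves `R` as well.
    · have hinj : Function.Injective ((LinearMap.mulLeft L x).restrict hx) := by
        intro r r' h
        exact Subtype.ext (mul_left_cancel₀ h0 (congrArg Subtype.val h))
      obtain ⟨r', hr'⟩ := LinearMap.surjective_of_injective hinj ⟨r, hr⟩
      have h1 : x * r' = r := congrArg Subtype.val hr'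
      rw [← h1, inv_mul_cancel_left₀ h0]
      exact r'.2

theorem Submodule.finrank_dvd_of_le_multiplierField (R : Submodule L E) [FiniteDimensional L R]
    {M : IntermediateField L E} (hM : M ≤ R.multiplierField) :
    Module.finrank L M ∣ Module.finrank L R := by
  let R' : Submodule M E :=
    { R with smul_mem' := fun m r hr => hM m.2 r hr }
  have h : Module.finrank L M * Module.finrank M R' = Module.finrank L R' :=
    Module.finrank_mul_finrank L M R'
  exact ⟨_, h.symm⟩

/-- If a subspace `T` of dimension at least `2 ^ s` consists of square roots of elements of `L` and
maps `R` into itself, then the dimension of `R` is divisible by `2 ^ s`. -/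
theorem Submodule.two_pow_dvd_finrank [CharP L 2] (R : Submodule L E) [FiniteDimensional L R]
    (T : Submodule L E) (hT : ∀ t ∈ T, t ^ 2 ∈ (algebraMap L E).range)
    (hTR : ∀ t ∈ T, ∀ r ∈ R, t * r ∈ R) {s : ℕ} (hs : 2 ^ s ≤ Module.finrank L T) :
    2 ^ s ∣ Module.finrank L R := by
  rcases eq_or_ne R ⊥ with rfl | hR
  · simp
  obtain ⟨r, hr, hr0⟩ := R.exists_mem_ne_zero_of_ne_bot hR
  -- `R` is a vector space over `M = L(T)`. This field is finite over `L`, as `m ↦ m r` embeds it in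
  -- `R`, and purely inseparable, so its degree is a power of two, at least `dim T`.
  let M := IntermediateField.adjoin L (T : Set E)
  have hM : M ≤ R.multiplierField := IntermediateField.adjoin_le_iff.2 hTR
  have hfin : FiniteDimensional L M := by
    refine FiniteDimensional.of_injective
      (LinearMap.codRestrict R ((LinearMap.mulRight L r).comp M.val.toLinearMap)
        fun m => hM m.2 r hr) fun m m' h => ?_
    exact Subtype.ext (mul_right_cancel₀ hr0 (congrArg Subtype.val h))
  have : IsPurelyInseparable L M := by
    rw [IntermediateField.isPurelyInseparable_adjoin_iff_pow_mem L E 2]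
    exact fun t ht => ⟨1, by simpa using hT t ht⟩
  obtain ⟨n, hn⟩ := IsPurelyInseparable.finrank_eq_pow (F := L) M 2
  have hle : Module.finrank L T ≤ Module.finrank L M :=
    Submodule.finrank_mono (s := T) (t := Subalgebra.toSubmodule M.toSubalgebra)
      (IntermediateField.subset_adjoin L _)
  refine (pow_dvd_pow 2 ((Nat.pow_le_pow_iff_right one_lt_two).1 ?_)).trans
    (hn ▸ R.finrank_dvd_of_le_multiplierField hM)
  exact hn ▸ hs.trans hle

end Stabilizer

/-- The extension is purely inseparable, so its finite degree is a power of two and `Nat.log` loses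
nothing: a basis has exactly the stated number of members. -/
theorem Subfield.exists_linearIndependent_over_squares {F : Type*} [Field F] [CharP F 2]
    {N : Subfield F} (hN : (frobenius F 2).fieldRange ≤ N)
    (h0 : Subfield.relfinrank (frobenius F 2).fieldRange N ≠ 0) :
    ∃ d : Fin (2 ^ Nat.log 2 (Subfield.relfinrank (frobenius F 2).fieldRange N)) → F,
      (∀ b, d b ∈ N) ∧ ∀ t : _ → F, ∑ b, d b * t b ^ 2 = 0 → t = 0 := by
  let A := (frobenius F 2).fieldRange
  let M := Subfield.extendScalars hN
  have hr : Subfield.relfinrank A N = Module.finrank A M :=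
    Subfield.relfinrank_eq_finrank_of_le hN
  have hfin : FiniteDimensional A M := FiniteDimensional.of_finrank_pos (Nat.pos_of_ne_zero (hr ▸ h0))
  have : CharP A 2 := (algebraMap A F).charP (algebraMap A F).injective 2
  have : IsPurelyInseparable A M := by
    rw [isPurelyInseparable_iff_pow_mem A 2]
    exact fun x => ⟨1, ⟨(x : F) ^ 2, x, rfl⟩, Subtype.ext (by simp; rfl)⟩
  obtain ⟨n, hn⟩ := IsPurelyInseparable.finrank_eq_pow (F := A) M 2
  have hlog : 2 ^ Nat.log 2 (Subfield.relfinrank A N) = Module.finrank A M := by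
    rw [hr, hn, Nat.log_pow one_lt_two]
  let e := Module.finBasisOfFinrankEq A M hlog.symm
  refine ⟨fun b => (e b : F), fun b => (e b).2, fun t ht => ?_⟩
  have h1 := Fintype.linearIndependent_iff.1 e.linearIndependent
    (fun b => ⟨t b ^ 2, t b, rfl⟩) ?_
  · ext b
    have := congrArg Subtype.val (h1 b)
    exact pow_eq_zero_iff two_ne_zero |>.1 this
  · apply Subtype.ext
    rw [← show ((0 : M) : F) = 0 from rfl] at ht
    rw [← ht, AddSubmonoidClass.coe_finsetSum]
    exact Finset.sum_congr rfl fun b _ => mul_comm _ _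

/-! ### Values, scalar extension and quasi-Pfister forms -/

namespace QuasilinearForm

section Values

variable {F : Type u} {V : Type v} [Field F] [AddCommGroup V] [Module F V]

theorem toAddHom_eq_sum {ι : Type*} [Fintype ι] (q : QuasilinearForm F V)
    (e : Module.Basis ι F V) (x : V) :
    q.toAddHom x = ∑ b, q.toAddHom (e b) * (e.repr x b * e.repr x b) := by
  conv_lhs => rw [← e.sum_repr x, map_sum]
  exact Finset.sum_congr rfl fun b _ => by rw [toAddHom_smul, mul_comm]

theorem Anisotropic.eq_zero_of_sum_eq_zero {ι : Type*} [Fintype ι] {q : QuasilinearForm F V}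
    (hq : q.Anisotropic) (e : Module.Basis ι F V) (t : ι → F)
    (ht : ∑ b, q.toAddHom (e b) * t b ^ 2 = 0) : t = 0 := by
  have h : e.equivFun.symm t = 0 := by
    apply hq
    change q.toAddHom _ = 0
    rw [q.toAddHom_eq_sum e, ← ht]
    refine Finset.sum_congr rfl fun b _ => ?_
    rw [← e.equivFun_apply, LinearEquiv.apply_symm_apply, sq]
  exact (LinearEquiv.map_eq_zero_iff _).1 h

theorem anisotropic_anisotropicPart (q : QuasilinearForm F V) : q.anisotropicPart.Anisotropic := by
  intro x hx
  obtain ⟨y, rfl⟩ := Submodule.Quotient.mk_surjective _ x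
  exact (Submodule.Quotient.mk_eq_zero _).2 hx

theorem fieldRange_frobenius_le_normField [CharP F 2] {q : QuasilinearForm F V} {x : V}
    (hx : q.toAddHom x ≠ 0) : (frobenius F 2).fieldRange ≤ q.normField := by
  rintro _ ⟨c, rfl⟩
  rcases eq_or_ne c 0 with rfl | hc
  · rw [map_zero]; exact zero_mem _
  refine Subfield.subset_closure ⟨q.toAddHom (c • x), ⟨_, rfl⟩, q.toAddHom x, ⟨_, rfl⟩, ?_, hx, ?_⟩
  · rw [toAddHom_smul]
    exact mul_ne_zero (mul_ne_zero hc hc) hx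
  · rw [toAddHom_smul, mul_div_cancel_right₀ _ hx, frobenius_def, sq]

theorem tensor_tmul {W : Type w} [AddCommGroup W] [Module F W] (p : QuasilinearForm F V)
    (q : QuasilinearForm F W) (x : V) (y : W) :
    (p.tensor q).toAddHom (x ⊗ₜ y) = p.toAddHom x * q.toAddHom y := rfl

end Values

section BaseChange

variable {F : Type u} {V : Type v} [Field F] [AddCommGroup V] [Module F V]
  {L : Type w} [Field L] [Algebra F L] [CharP L 2]

theorem baseChange_tmul (q : QuasilinearForm F V) (l : L) (x : V) :
    (q.baseChange L).toAddHom (l ⊗ₜ x) = l * l * algebraMap F L (q.toAddHom x) := rfl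

variable {E : Type*} [Field E] [Algebra F E] [Algebra L E] [IsScalarTower F L E] [CharP E 2]
  [PerfectRing E 2] {ι : Type*} [Fintype ι]

theorem sqrtComb_repr_sq (q : QuasilinearForm F V) (e : Module.Basis ι F V) (x : L ⊗[F] V) :
    sqrtComb (E := E) L (fun b => q.toAddHom (e b)) ((e.baseChange L).equivFun x) ^ 2 =
      algebraMap L E ((q.baseChange L).toAddHom x) := by
  rw [sqrtComb_sq, (q.baseChange L).toAddHom_eq_sum (e.baseChange L)]
  simp [baseChange_tmul, Module.Basis.baseChange_apply]

/-- This frees the range from the choice of basis, so that multiplicative properties of the set of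
values carry over to it. -/
theorem mem_range_sqrtComb_iff (q : QuasilinearForm F V) (e : Module.Basis ι F V) (y : E) :
    y ∈ LinearMap.range (sqrtComb (E := E) L fun b => q.toAddHom (e b)) ↔
      ∃ x, algebraMap L E ((q.baseChange L).toAddHom x) = y ^ 2 := by
  constructor
  · rintro ⟨t, rfl⟩
    refine ⟨(e.baseChange L).equivFun.symm t, ?_⟩
    rw [← sqrtComb_repr_sq q e, LinearEquiv.apply_symm_apply]
  · rintro ⟨x, hx⟩
    rw [← sqrtComb_repr_sq q e] at hx
    exact ⟨_, CharTwo.eq_of_sq_eq_sq hx⟩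

variable (E) in
theorem isotropyIndex_baseChange_eq (q : QuasilinearForm F V) (e : Module.Basis ι F V) :
    (q.baseChange L).isotropyIndex =
      Module.finrank L (LinearMap.ker (sqrtComb (E := E) L fun b => q.toAddHom (e b))) := by
  have h : (q.baseChange L).isotropicVectors.map ((e.baseChange L).equivFun : _ →ₗ[L] ι → L) =
      LinearMap.ker (sqrtComb (E := E) L fun b => q.toAddHom (e b)) := by
    ext t
    rw [Submodule.mem_map_equiv, LinearMap.mem_ker, ← sq_eq_zero_iff]
    conv_rhs => rw [← (e.baseChange L).equivFun.apply_symm_apply t, sqrtComb_repr_sq, map_eq_zero]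
    rfl
  rw [isotropyIndex, ← (e.baseChange L).equivFun.finrank_map_eq, h]

end BaseChange

section Pfister

variable {F : Type u} {V : Type v} [Field F] [CharP F 2] [AddCommGroup V] [Module F V]
  {s : ℕ}

theorem quasiPfister_apply (a : Fin s → Fˣ) (x : Finset (Fin s) → F) :
    (quasiPfister a).toAddHom x = ∑ S, (∏ i ∈ S, (a i : F)) * (x S * x S) := rfl

/-- The values of a quasi-Pfister form are closed under multiplication. -/
theorem exists_quasiPfister_eq_mul (a : Fin s → Fˣ) (x y : Finset (Fin s) → F) :
    ∃ z, (quasiPfister a).toAddHom z = (quasiPfister a).toAddHom x * (quasiPfister a).toAddHom y := by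
  classical
  rw [← AddMonoidHom.mem_range, quasiPfister_apply a x, quasiPfister_apply a y, Finset.sum_mul_sum]
  refine sum_mem fun S _ => sum_mem fun T _ => ?_
  -- The values form an additive group, so one term of each sum suffices; there `a_S a_T = a_(S ∆ T)
  -- (a_(S ∩ T))²`.
  refine ⟨Pi.single (symmDiff S T) (x S * y T * ∏ i ∈ S ∩ T, (a i : F)), ?_⟩
  have h : (∏ i ∈ S, (a i : F)) * ∏ i ∈ T, (a i : F) =
      (∏ i ∈ symmDiff S T, (a i : F)) * ((∏ i ∈ S ∩ T, (a i : F)) * ∏ i ∈ S ∩ T, (a i : F)) := by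
    rw [← Finset.prod_union_inter, ← mul_assoc,
      show S ∪ T = symmDiff S T ∪ S ∩ T from (symmDiff_sup_inf S T).symm,
      Finset.prod_union (show Disjoint (symmDiff S T) (S ∩ T) from disjoint_symmDiff_inf S T)]
  rw [quasiPfister_apply, Finset.sum_eq_single (symmDiff S T)]
  · simp only [Pi.single_eq_same]
    linear_combination (-(x S * x S * (y T * y T))) * h
  · intro U _ hU
    simp [hU]
  · simp

/-- If the anisotropic part of a nonzero form `q` is divisible by a quasi-Pfister form `π`, then `π`
is anisotropic and the values of `q` are stable under multiplication by the values of `π`. -/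
theorem DivisibleBy.quasiPfister_anisotropic_and_mul {q : QuasilinearForm F V} {a : Fin s → Fˣ}
    (h : q.anisotropicPart.DivisibleBy (quasiPfister a)) (hq : ∃ x, q.toAddHom x ≠ 0) :
    (∀ t, (quasiPfister a).toAddHom t = 0 → t = 0) ∧
      ∀ t x, ∃ y, q.toAddHom y = (quasiPfister a).toAddHom t * q.toAddHom x := by
  obtain ⟨m, r, ⟨e⟩⟩ := h
  have he (x) : ((quasiPfister a).tensor r).toAddHom (e x) = q.anisotropicPart.toAddHom x :=
    e.map_app x
  have hrange (z) : ∃ y, q.toAddHom y = ((quasiPfister a).tensor r).toAddHom z := by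
    obtain ⟨x, rfl⟩ := e.toEquiv.surjective z
    obtain ⟨y, rfl⟩ := Submodule.Quotient.mk_surjective _ x
    exact ⟨y, (he (Submodule.Quotient.mk y)).symm⟩
  refine ⟨fun t ht => ?_, fun t x => ?_⟩
  · obtain ⟨x, hx⟩ := hq
    obtain ⟨w, hw⟩ : ∃ w, r.toAddHom w ≠ 0 := by
      by_contra! hr
      apply hx
      change q.anisotropicPart.toAddHom (Submodule.Quotient.mk x) = 0
      rw [← he]
      induction e (Submodule.Quotient.mk x) using TensorProduct.induction_on with
      | zero => exact map_zero _
      | add z z' hz hz' => rw [map_add, hz, hz', add_zero]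
      | tmul z w => rw [tensor_tmul, hr, mul_zero]
    have hw0 : w ≠ 0 := by rintro rfl; exact hw (map_zero _)
    -- An isotropic `t` makes `t ⊗ w` isotropic for a form isometric to an anisotropic one; since `w
    -- ≠ 0`, this kills `t`.
    have h1 : t ⊗ₜ[F] w = 0 := by
      obtain ⟨x, hx⟩ := e.toEquiv.surjective (t ⊗ₜ[F] w)
      have hx' : e x = t ⊗ₜ[F] w := hx
      have h0 : q.anisotropicPart.toAddHom x = 0 := by
        rw [← he, hx', tensor_tmul, ht, zero_mul]
      rw [← hx', q.anisotropic_anisotropicPart x h0]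
      exact map_zero e.toLinearEquiv
    obtain ⟨b, hb⟩ := Function.ne_iff.1 hw0
    ext S
    have h2 := congrArg (TensorProduct.lid F F) (congrArg
      (TensorProduct.map (LinearMap.proj S) (LinearMap.proj b)) h1)
    simpa [show w b ≠ 0 from hb] using h2
  · rw [← show q.anisotropicPart.toAddHom (Submodule.Quotient.mk x) = q.toAddHom x from rfl, ← he]
    suffices h1 : ∀ z, (quasiPfister a).toAddHom t * ((quasiPfister a).tensor r).toAddHom z ∈
        ((quasiPfister a).tensor r).toAddHom.range by
      obtain ⟨z, hz⟩ := h1 (e (Submodule.Quotient.mk x))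
      rw [← hz]
      exact hrange z
    intro z
    induction z using TensorProduct.induction_on with
    | zero => rw [map_zero, mul_zero]; exact zero_mem _
    | add z z' hz hz' => rw [map_add, mul_add]; exact add_mem hz hz'
    | tmul z w =>
      obtain ⟨z', hz'⟩ := exists_quasiPfister_eq_mul a t z
      exact ⟨z' ⊗ₜ w, by rw [tensor_tmul, tensor_tmul, hz', mul_assoc]⟩

end Pfister

section FunctionField

open MvPolynomial

variable {F : Type u} {V : Type v} [Field F] [AddCommGroup V] [Module F V]
  [FiniteDimensional F V]

/-- The algebraic closure of `F[p]` serves: individual forms have a class there, while in `F(p)`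
only their quotients of degree zero do. -/
theorem exists_perfect_extension_of_functionField [CharP F 2] (p : QuasilinearForm F V)
    (hp : p.Anisotropic) (hd : 2 ≤ Module.finrank F V) :
    ∃ (E : Type u) (_ : Field E) (_ : CharP E 2) (_ : PerfectRing E 2) (_ : Algebra F E)
      (_ : Algebra (p.FunctionField hp hd) E) (_ : IsScalarTower F (p.FunctionField hp hd) E)
      (c : MvPolynomial (Fin (Module.finrank F V)) F →ₐ[F] E),
      IsHomogeneousFractions (p.FunctionField hp hd) c ∧ ∀ f, c f = 0 ↔ p.polynomial ∣ f := by
  let _ := p.affineField hp hd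
  have := p.isDomain_coordinateRing hp hd
  let K := p.degreeZeroFractions hp hd
  let E := AlgebraicClosure p.AffineFunctionField
  let φ : p.FunctionField hp hd →+* E :=
    (algebraMap p.AffineFunctionField E).comp (K.val : K →+* p.AffineFunctionField)
  let _ : Algebra (p.FunctionField hp hd) E := φ.toAlgebra
  have : IsScalarTower F (p.FunctionField hp hd) E := IsScalarTower.of_algebraMap_eq fun _ => rfl
  have : CharP E 2 := charP_of_injective_algebraMap (algebraMap F E).injective 2
  have hmap (x : K) : algebraMap (p.FunctionField hp hd) E x =
    algebraMap p.AffineFunctionField E x.1 := rfl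
  refine ⟨E, inferInstance, this, inferInstance, inferInstance, inferInstance, inferInstance,
    (IsScalarTower.toAlgHom F p.AffineFunctionField E).comp p.polyClass, ⟨fun x => ?_,
      fun n f g hf hg h0 => ?_⟩, fun f => ?_⟩
  · obtain ⟨x, n, f, g, hf, hg, h0, rfl⟩ := x
    refine ⟨n, f, g, hf, hg, ?_, ?_⟩
    · simpa using h0
    · rw [hmap, map_div₀]
      rfl
  · refine ⟨(⟨p.polyClass f / p.polyClass g, n, f, g, hf, hg, ?_, rfl⟩ : K), ?_⟩
    · simpa using h0
    · rw [hmap, map_div₀]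
      rfl
  · simp [polyClass, Ideal.Quotient.eq_zero_iff_mem, Ideal.mem_span_singleton]

theorem not_polynomial_dvd_X (p : QuasilinearForm F V) (hp : p.polynomial ≠ 0)
    (i : Fin (Module.finrank F V)) : ¬ p.polynomial ∣ X i := by
  rintro ⟨h, hh⟩
  have hhom : p.polynomial.IsHomogeneous 2 := by
    refine IsHomogeneous.sum _ _ _ fun j _ => ?_
    simpa using (isHomogeneous_C _ _).mul ((isHomogeneous_X F j).pow 2)
  have h0 : h ≠ 0 := by
    rintro rfl
    rw [mul_zero] at hh
    exact X_ne_zero i hh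
  have := totalDegree_mul_of_isDomain hp h0
  rw [← hh, totalDegree_X, hhom.totalDegree hp] at this
  omega

end FunctionField

end QuasilinearForm

theorem Submodule.finrank_map_mulLeft {L E : Type*} [Field L] [Field E] [Algebra L E]
    (R : Submodule L E) {x : E} (hx : x ≠ 0) :
    Module.finrank L (R.map (LinearMap.mulLeft L x)) = Module.finrank L R :=
  (Submodule.equivMapOfInjective _ (mul_right_injective₀ hx) R).finrank_eq.symm

/-! ### Stability under the norm field and under quasi-Pfister divisors -/

namespace QuasilinearForm

section Stable

variable {F : Type u} {V : Type v} [Field F] [AddCommGroup V] [Module F V]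
  {L E : Type*} [Field L] [Field E] [Algebra F E] [Algebra L E] [CharP E 2] [PerfectRing E 2]

/-- If every `√(p v)` with `p v ≠ 0` maps `R` onto the same space, then `R` is stable under the
square roots of the elements of the norm field of `p`. -/
theorem sqrtMap_mul_mem_of_mem_normField (p : QuasilinearForm F V) (R S : Submodule L E)
    [FiniteDimensional L R]
    (h : ∀ v, p.toAddHom v ≠ 0 → R.map (LinearMap.mulLeft L (sqrtMap F E (p.toAddHom v))) = S)
    {x : F} (hx : x ∈ p.normField) {r : E} (hr : r ∈ R) : sqrtMap F E x * r ∈ R := by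
  -- The `x` with `√x R ⊆ R` form a subfield of `F`, so only the generating ratios `p(v) / p(w)`
  -- matter.
  suffices hN : p.normField ≤ R.multiplierField.toSubfield.comap (sqrtMap F E) from hN hx r hr
  refine Subfield.closure_le.2 ?_
  rintro _ ⟨_, ⟨v, rfl⟩, _, ⟨w, rfl⟩, hv, hw, rfl⟩ r hr
  have h1 : sqrtMap F E (p.toAddHom v) * r ∈
      R.map (LinearMap.mulLeft L (sqrtMap F E (p.toAddHom w))) := by
    rw [h w hw, ← h v hv]
    exact ⟨r, hr, rfl⟩
  obtain ⟨r', hr', hrr'⟩ := h1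
  have hw' : sqrtMap F E (p.toAddHom w) ≠ 0 := (map_ne_zero _).2 hw
  have h2 : sqrtMap F E (p.toAddHom v / p.toAddHom w) * r = r' := by
    rw [map_div₀, div_mul_eq_mul_div, div_eq_iff hw', mul_comm r']
    exact hrr'.symm
  exact h2 ▸ hr'

theorem sq_mem_range_of_mem_range_sqrtComb [Algebra F L] [IsScalarTower F L E]
    {ι : Type*} [Fintype ι] (d : ι → F) {t : E}
    (ht : t ∈ LinearMap.range (sqrtComb (E := E) L d)) : t ^ 2 ∈ (algebraMap L E).range := by
  obtain ⟨t, rfl⟩ := ht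
  exact ⟨_, (sqrtComb_sq d t).symm⟩

theorem mul_mem_of_mem_range_sqrtComb {ι : Type*} [Fintype ι] {d : ι → F} {R S : Submodule L E}
    (h : ∀ b, ∀ r ∈ R, sqrtMap F E (d b) * r ∈ S) {t : E}
    (ht : t ∈ LinearMap.range (sqrtComb (E := E) L d)) {r : E} (hr : r ∈ R) : t * r ∈ S := by
  obtain ⟨t, rfl⟩ := ht
  rw [sqrtComb_apply, Finset.sum_mul]
  refine sum_mem fun b _ => ?_
  rw [mul_assoc, ← Algebra.smul_def]
  exact S.smul_mem _ (h b r hr)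

/-- If a quasi-Pfister form over `L` divides the anisotropic part of a nonzero form `Q` and the
subspace of `E` consisting of the square roots of values of `Q` is `A`, then the dimension of
`A * R` is divisible by the dimension of the quasi-Pfister form. -/
theorem DivisibleBy.two_pow_dvd_finrank_mul [CharP L 2] {X : Type*} [AddCommGroup X] [Module L X]
    {Q : QuasilinearForm L X} {s : ℕ} {a : Fin s → Lˣ}
    (h : Q.anisotropicPart.DivisibleBy (quasiPfister a)) (hQ : ∃ x, Q.toAddHom x ≠ 0)
    {A R : Submodule L E} (hA : ∀ y, y ∈ A ↔ ∃ x, algebraMap L E (Q.toAddHom x) = y ^ 2)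
    [FiniteDimensional L (A * R : Submodule L E)] :
    2 ^ s ∣ Module.finrank L (A * R : Submodule L E) := by
  obtain ⟨hπ, hmul⟩ := h.quasiPfister_anisotropic_and_mul hQ
  let d : Finset (Fin s) → L := fun S => ∏ i ∈ S, (a i : L)
  have hsq (t) : sqrtComb (E := E) L d t ^ 2 = algebraMap L E ((quasiPfister a).toAddHom t) :=
    sqrtComb_sq d t
  refine (A * R).two_pow_dvd_finrank (LinearMap.range (sqrtComb (E := E) L d))
    (fun t ht => sq_mem_range_of_mem_range_sqrtComb d ht) ?_ ?_
  · rintro _ ⟨t, rfl⟩ r hr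
    refine Submodule.mul_induction_on hr (fun y hy r hr => ?_) fun y y' hy hy' => ?_
    · rw [← mul_assoc]
      refine Submodule.mul_mem_mul ?_ hr
      obtain ⟨x, hx⟩ := (hA y).1 hy
      obtain ⟨z, hz⟩ := hmul t x
      exact (hA _).2 ⟨z, by rw [hz, map_mul, hx, mul_pow, hsq]⟩
    · rw [mul_add]
      exact add_mem hy hy'
  -- Anisotropy of the quasi-Pfister form makes its square root map injective, so the multipliers
  -- span dimension `2 ^ s`.
  · rw [LinearMap.finrank_range_of_inj, Module.finrank_fintype_fun_eq_card, Fintype.card_finset,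
      Fintype.card_fin]
    rw [injective_iff_map_eq_zero]
    intro t ht
    apply hπ
    rw [← map_eq_zero (algebraMap L E), ← hsq, ht, zero_pow two_ne_zero]

end Stable

section Divisibility

variable {F : Type u} {V : Type v} [Field F] [CharP F 2] [AddCommGroup V] [Module F V]

/-- `sSup` takes the value `0` on an empty or unbounded set of naturals. The alternative avoids
proving boundedness and suffices, since `2 ^ 0` divides everything. -/
theorem divisibilityIndex_eq_zero_or_exists (q : QuasilinearForm F V) :
    q.divisibilityIndex = 0 ∨ ∃ a : Fin q.divisibilityIndex → Fˣ,
      q.anisotropicPart.DivisibleBy (quasiPfister a) := by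
  rw [or_iff_not_imp_left]
  intro h
  have hb : BddAbove {s : ℕ | ∃ a : Fin s → Fˣ,
      q.anisotropicPart.DivisibleBy (quasiPfister a)} := by
    by_contra hb
    exact h (Nat.sSup_of_not_bddAbove hb)
  refine Nat.sSup_mem ?_ hb
  rw [Set.nonempty_iff_ne_empty]
  intro he
  exact h (by rw [divisibilityIndex, he, csSup_empty]; rfl)

end Divisibility

end QuasilinearForm

/-! ### The main theorem -/

open QuasilinearForm in
theorem theorem6p13 {F : Type u} [Field F] [CharP F 2]
    {V : Type v} [AddCommGroup V] [Module F V] [FiniteDimensional F V]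
    {W : Type w} [AddCommGroup W] [Module F W] [FiniteDimensional F W]
    (p : QuasilinearForm F V) (q : QuasilinearForm F W)
    (hp : p.Anisotropic) (hq : q.Anisotropic)
    (hpd : 2 ≤ Module.finrank F V) (hqd : 2 ≤ Module.finrank F W)
    (ε : ℕ) (hε1 : 1 ≤ ε) (hε2 : ε ≤ 2 ^ p.firstDivisibilityIndex hp hpd)
    (hε : (q.extendToFunctionField p hp hpd).isotropyIndex + ε ≡ 0
      [MOD 2 ^ p.firstDivisibilityIndex hp hpd]) :
    ((q.extendToFunctionField p hp hpd).isotropyIndex : ℚ) ≤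
        ((Module.finrank F W : ℚ) - (ε : ℚ)) / 2 ∨
      2 ^ (p.lndeg - 1) ∣ (q.extendToFunctionField p hp hpd).isotropyIndex := by
  obtain ⟨E, _, _, _, _, _, _, c, hc, hker⟩ := p.exists_perfect_extension_of_functionField hp hpd
  let L := p.FunctionField hp hpd
  let e := Module.finBasis F V
  let e' := Module.finBasis F W
  let i₀ : Fin (Module.finrank F V) := ⟨0, by omega⟩
  let a := fun i => p.toAddHom (e i)
  let d := fun b => q.toAddHom (e' b)
  have ha0 : a i₀ ≠ 0 := fun h => e.ne_zero i₀ (hp _ h)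
  have hX : c (MvPolynomial.X i₀) ≠ 0 := by
    rw [Ne, hker]
    exact p.not_polynomial_dvd_X (p.irreducible_polynomial hp hpd).ne_zero i₀
  have hmain {ι : Type} [Fintype ι] {d : ι → F} (hd : ∀ t : ι → F, ∑ b, d b * t b ^ 2 = 0 → t = 0) :=
    exists_submodule_mul_mem_range_sqrtComb hc a hker ha0 hX hd
  have hi : (q.extendToFunctionField p hp hpd).isotropyIndex =
      Module.finrank L (LinearMap.ker (sqrtComb (E := E) L d)) :=
    q.isotropyIndex_baseChange_eq E e'
  have hdim := finrank_ker_sqrtComb_add (L := L) (E := E) d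
  rw [Fintype.card_fin, ← hi] at hdim
  obtain ⟨R, _, hR, hRD⟩ := hmain (hq.eq_zero_of_sum_eq_zero e')
  rw [← hi] at hR
  let A := LinearMap.range (sqrtComb (E := E) L a)
  have hAD : A * R ≤ LinearMap.range (sqrtComb (E := E) L d) :=
    Submodule.mul_le.2 fun x hx r hr => mul_mem_of_mem_range_sqrtComb hRD hx hr
  have : FiniteDimensional L (A * R : Submodule L E) := Submodule.finiteDimensional_of_le hAD
  have hAR : Module.finrank L (A * R : Submodule L E) ≤
      Module.finrank L (LinearMap.range (sqrtComb (E := E) L d)) := Submodule.finrank_mono hAD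
  have hmemA (y : E) : y ∈ A ↔
      ∃ x, algebraMap L E ((p.extendToFunctionField p hp hpd).toAddHom x) = y ^ 2 :=
    p.mem_range_sqrtComb_iff e y
  have hvA (v : V) : sqrtMap F E (p.toAddHom v) ∈ A := by
    refine (hmemA _).2 ⟨1 ⊗ₜ v, ?_⟩
    rw [sqrtMap_sq, extendToFunctionField, baseChange_tmul, one_mul, one_mul,
      ← IsScalarTower.algebraMap_apply]
  have hmap (v : V) : R.map (LinearMap.mulLeft L (sqrtMap F E (p.toAddHom v))) ≤ A * R := by
    rintro _ ⟨r, hr, rfl⟩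
    exact Submodule.mul_mem_mul (hvA v) hr
  have hmapdim (v : V) (hv : p.toAddHom v ≠ 0) :
      Module.finrank L (R.map (LinearMap.mulLeft L (sqrtMap F E (p.toAddHom v)))) =
        Module.finrank L R := R.finrank_map_mulLeft ((map_ne_zero _).2 hv)
  have hge : Module.finrank L R ≤ Module.finrank L (A * R : Submodule L E) := by
    rw [← hmapdim _ ha0]
    exact Submodule.finrank_mono (hmap _)
  -- Either `A R` is strictly larger than `R`, or each `√p(v) R` with `p(v) ≠ 0` already fills `A
  -- R`.
  rcases hge.lt_or_eq with hlt | heq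
  · left
    have hdvd : 2 ^ p.firstDivisibilityIndex hp hpd ∣
        Module.finrank L (A * R : Submodule L E) := by
      rcases divisibilityIndex_eq_zero_or_exists
        (p.extendToFunctionField p hp hpd).anisotropicPart with h | ⟨π, h⟩
      · rw [firstDivisibilityIndex, h]
        exact one_dvd _
      · refine h.two_pow_dvd_finrank_mul ?_ fun y => ?_
        · refine ⟨Submodule.Quotient.mk (1 ⊗ₜ e i₀), ?_⟩
          change (p.baseChange L).toAddHom (1 ⊗ₜ e i₀) ≠ 0
          rw [baseChange_tmul, one_mul, one_mul]
          exact (map_ne_zero _).2 ha0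
        · rw [hmemA, (Submodule.Quotient.mk_surjective _).exists]
          rfl
    rw [hR] at hlt
    have h1 := (Nat.modEq_zero_iff_dvd.1 hε)
    -- Otherwise `i + ε - dim A R` would be a positive multiple of `2 ^ 𝔡₁(p)` smaller than `ε`.
    have h2 : ε ≤ Module.finrank L (A * R : Submodule L E) -
        (q.extendToFunctionField p hp hpd).isotropyIndex := by
      by_contra! h3
      have h4 := Nat.le_of_dvd (by omega) (Nat.dvd_sub h1 hdvd)
      omega
    have h3 : 2 * (q.extendToFunctionField p hp hpd).isotropyIndex + ε ≤ Module.finrank F W := by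
      omega
    have h4 : (2 * (q.extendToFunctionField p hp hpd).isotropyIndex + ε : ℚ) ≤
      Module.finrank F W := mod_cast h3
    linarith
  · right
    rcases eq_or_ne (Subfield.relfinrank (frobenius F 2).fieldRange p.normField) 0 with h0 | h0
    -- The value `0` stands for infinite degree; then `lndeg` is `0` and the divisor is `1`.
    · simp [lndeg, h0]
    obtain ⟨n, hnN, hn⟩ := Subfield.exists_linearIndependent_over_squares
      (fieldRange_frobenius_le_normField ha0) h0
    obtain ⟨R', _, hR', hRN⟩ := hmain hn
    have hndim : Module.finrank L R' +
        Module.finrank L (LinearMap.range (sqrtComb (E := E) L n)) = 2 ^ p.lndeg := by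
      rw [hR']
      exact (finrank_ker_sqrtComb_add n).trans (Fintype.card_fin _)
    -- Multiplication by `√a_(i₀)` embeds `R'` into the range, so the kernel is at most half of the
    -- total dimension `2 ^ lndeg(p)`.
    have hker' : Module.finrank L R' ≤
        Module.finrank L (LinearMap.range (sqrtComb (E := E) L n)) := by
      rw [← R'.finrank_map_mulLeft ((map_ne_zero (sqrtMap F E)).2 ha0)]
      refine Submodule.finrank_mono ?_
      rintro _ ⟨r, hr, rfl⟩
      exact hRN i₀ r hr
    rw [← hR]
    refine R.two_pow_dvd_finrank (LinearMap.range (sqrtComb (E := E) L n))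
      (fun t ht => sq_mem_range_of_mem_range_sqrtComb n ht)
      (fun t ht r hr => mul_mem_of_mem_range_sqrtComb (fun b r hr =>
        p.sqrtMap_mul_mem_of_mem_normField R (A * R) (fun v hv => ?_) (hnN b) hr) ht hr) ?_
    · exact Submodule.eq_of_le_of_finrank_eq (hmap v) ((hmapdim v hv).trans heq)
    · change 2 ^ (p.lndeg - 1) ≤ Module.finrank L (LinearMap.range (sqrtComb (E := E) L n))
      -- For `lndeg = 0` the truncated exponent is `0`; the dimensions then add up to `1`, so the
      -- range is a line.
      rcases Nat.eq_zero_or_pos p.lndeg with h | h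
      · rw [h] at hndim ⊢
        simp only [pow_zero, Nat.zero_sub] at hndim ⊢
        omega
      · have h2 : 2 ^ p.lndeg = 2 * 2 ^ (p.lndeg - 1) := by
          rw [← pow_succ', Nat.sub_add_cancel h]
        omega
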